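/- Let $F$ be a finite forest, that is, a finite simple graph without cycles (for instance a tree), with at least one vertex, and let $\overline F$ be its graph complement. Terminology. In a finite simple graph $G$, the unit sphere $S(x)$ of a vertex $x$ is the subgraph induced by the neighbours of $x$. The graph $G$ is contractible if it is a one-point graph or, inductively, if it has a vertex $x$ such that both $S(x)$ and $G-x$ are contractible. Two graphs are homotopic if they are related by the equivalence relation generated by isomorphism and by the homotopy reductions $G\to G-x$, where $x$ is a vertex with contractible $S(x)$ (the inverse steps are the homotopy extensions). The $(-1)$-sphere is the empty graph; for $d\ge 0$, a discrete $d$-sphere is a finite simple graph all of whose unit spheres are $(d-1)$-spheres and which has a vertex whose removal leaves a contractible graph. The Whitney complex of $G$ is the simplicial complex of nonempty cliques of $G$, and the independence complex $I(G)$ is the simplicial complex of nonempty independent sets of $G$; $|K|$ denotes the geometric realization of a finite simplicial complex $K$. Then $I(F)$ is the Whitney complex of $\overline F$, and at least one of the following holds: (a) the graph $\overline F$ is contractible, and the space $|I(F)|$ is contractible; (b) there is an integer $d\ge 0$ such that the graph $\overline F$ is homotopic to a discrete $d$-sphere, and the space $|I(F)|$ is homotopy equivalent to the unit sphere $\mathbb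 S^d\subset\mathbb R^{d+1}$. -/

import Mathlib

universe u

namespace GraphTop

/-- The unit sphere `S(x)` of a vertex: the subgraph induced by the neighbours of `x`. -/
abbrev unitSphere {V : Type u} (G : SimpleGraph V) (x : V) : SimpleGraph (G.neighborSet x) :=
  G.induce (G.neighborSet x)

/-- The graph `G - x`. -/
abbrev deleteVertex {V : Type u} (G : SimpleGraph V) (x : V) :
    SimpleGraph (({x} : Set V)ᶜ : Set V) :=
  G.induce ({x}ᶜ : Set V)

/-- Contractible graphs, in the inductive combinatorial sense: a one-point graph is contractible,
and `G` is contractible if some vertex `x` has a contractible unit sphere and a contractible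
complement `G - x`. That is, `G` can be reduced to a point by homotopy reductions alone. -/
inductive Contractible : ∀ {V : Type u}, SimpleGraph V → Prop
  | point {V : Type u} [Subsingleton V] [Nonempty V] (G : SimpleGraph V) : Contractible G
  | step {V : Type u} (G : SimpleGraph V) (x : V) (hS : Contractible (unitSphere G x))
      (hD : Contractible (deleteVertex G x)) : Contractible G

/-- Homotopy of graphs: the equivalence relation generated by isomorphisms and by homotopy
reductions, which delete a vertex whose unit sphere is contractible. The inverse of a
reduction is a homotopy extension, which adds a new vertex joined to exactly the vertices of a
contractible subgraph. -/
inductive Homotopic : ∀ {V W : Type u}, SimpleGraph V → SimpleGraph W → Prop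
  | iso {V W : Type u} {G : SimpleGraph V} {H : SimpleGraph W} (e : G ≃g H) : Homotopic G H
  | reduction {V : Type u} (G : SimpleGraph V) (x : V) (hx : Contractible (unitSphere G x)) :
      Homotopic G (deleteVertex G x)
  | symm {V W : Type u} {G : SimpleGraph V} {H : SimpleGraph W} (h : Homotopic G H) :
      Homotopic H G
  | trans {U V W : Type u} {F : SimpleGraph U} {G : SimpleGraph V} {H : SimpleGraph W}
      (h₁ : Homotopic F G) (h₂ : Homotopic G H) : Homotopic F H

/-- `IsSphere n G` says that `G` is a discrete `(n - 1)`-sphere (the index is shifted so that the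
recursion can start at the empty graph, the `(-1)`-sphere). A `d`-sphere is a graph
all of whose unit spheres are `(d - 1)`-spheres and which becomes contractible when a suitable
vertex is removed. -/
def IsSphere : ℕ → ∀ {V : Type u}, SimpleGraph V → Prop
  | 0, V, _ => IsEmpty V
  | n + 1, _, G => (∀ x, IsSphere n (unitSphere G x)) ∧ ∃ x, Contractible (deleteVertex G x)

/-- The graph `G` is homotopic to a discrete `d`-sphere. -/
def HomotopicToSphere (d : ℕ) {V : Type u} (G : SimpleGraph V) : Prop :=
  ∃ (W : Type u) (_ : Finite W) (H : SimpleGraph W), IsSphere (d + 1) H ∧ Homotopic G H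

/-- The Whitney complex of a graph: its faces are the nonempty finite cliques. -/
def whitneyComplex {V : Type u} (G : SimpleGraph V) : AbstractSimplicialComplex V where
  faces := {s | s.Nonempty ∧ G.IsClique (s : Set V)}
  isRelLowerSet_faces := fun _ hs =>
    ⟨hs.1, fun _ hts ht => ⟨ht, hs.2.subset (Finset.coe_subset.mpr hts)⟩⟩
  singleton_mem := fun v => ⟨Finset.singleton_nonempty v, by simp⟩

/-- The independence complex of a graph: its faces are the nonempty finite independent sets. -/
def independenceComplex {V : Type u} (G : SimpleGraph V) : AbstractSimplicialComplex V where
  faces := {s | s.Nonempty ∧ G.IsIndepSet (s : Set V)}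
  isRelLowerSet_faces := fun _ hs =>
    ⟨hs.1, fun _ hts ht => ⟨ht, Set.Pairwise.mono (Finset.coe_subset.mpr hts) hs.2⟩⟩
  singleton_mem := fun v => ⟨Finset.singleton_nonempty v, by simp [SimpleGraph.IsIndepSet]⟩

/-- The geometric realization of a simplicial complex on a finite vertex set `V`, as a subspace of
`ℝ^V`: the points of the standard simplex which are supported on a face. -/
def realization {V : Type u} [Fintype V] (K : AbstractSimplicialComplex V) : Set (V → ℝ) :=
  {p | p ∈ stdSimplex ℝ V ∧ ∃ s ∈ K, ∀ v, v ∉ s → p v = 0}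

end GraphTop

namespace GraphTop

/-! Say that `w` dominates `u` if they are distinct and nonadjacent and every neighbour of `u` is a
neighbour of `w`. Such a `w` can be deleted on both sides: in the complement its unit sphere is a
cone with apex `u` (`contractible_unitSphere_compl`), and in the realization all mass at `w` can
slide to `u`, a deformation retraction (`nonempty_homotopyEquiv_deleteVertex`). Since `G - w` is
again a forest, induction on the number of vertices leaves two terminal cases.

An isolated vertex makes both the complement and the realization cones. Otherwise there is neither
an isolated vertex nor a domination, and a longest-path argument shows that the forest is a perfect
matching (`existsUnique_adj_of_isAcyclic`). Its complement is then a cross polytope, whose boundary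
is carried onto the Euclidean sphere by exchanging the ℓ¹ and ℓ² normalizations. -/

theorem independenceComplex_eq_whitneyComplex_compl {V : Type u} (G : SimpleGraph V) :
    independenceComplex G = whitneyComplex Gᶜ := by
  ext s
  change (s.Nonempty ∧ G.IsIndepSet (s : Set V)) ↔ (s.Nonempty ∧ Gᶜ.IsClique (s : Set V))
  rw [SimpleGraph.isClique_compl]

/-! ### Complements: cones and cross polytopes -/

theorem induce_compl {V : Type u} (G : SimpleGraph V) (s : Set V) :
    Gᶜ.induce s = (G.induce s)ᶜ := by
  ext a b
  simp [SimpleGraph.compl_adj, Subtype.ext_iff]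

/-- The complement of a finite graph with an isolated vertex is a cone, hence contractible. -/
theorem contractible_compl_of_isolated {V : Type u} [Finite V] (G : SimpleGraph V) (u : V)
    (hu : ∀ v, ¬ G.Adj u v) : Contractible Gᶜ := by
  induction hn : Nat.card V using Nat.strong_induction_on generalizing V with
  | _ n ih =>
    have : Nonempty V := ⟨u⟩
    cases subsingleton_or_nontrivial V with
    | inl h => exact .point _
    | inr h =>
      obtain ⟨x, hx⟩ := exists_ne u
      -- Both the unit sphere of `x` and the deletion of `x` are of this kind, as the apex `u` is
      -- joined to `x` in the complement.
      have key : ∀ s : Set V, u ∈ s → x ∉ s → Contractible (Gᶜ.induce s) := by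
        intro s hus hxs
        rw [induce_compl]
        refine ih (Nat.card s) ?_ (G.induce s) ⟨u, hus⟩ (fun v => by simpa using hu v) rfl
        rw [← hn]
        exact Finite.card_subtype_lt hxs
      refine .step _ x (key _ ?_ (by simp)) (key _ (by simpa using hx.symm) (by simp))
      simpa [SimpleGraph.compl_adj, hx] using fun h => hu x h.symm

/-- In the complement, the unit sphere of a vertex dominating a nonadjacent one is contractible. -/
theorem contractible_unitSphere_compl {V : Type u} [Finite V] (G : SimpleGraph V) {u w : V}
    (hne : u ≠ w) (hadj : ¬ G.Adj u w) (hsub : ∀ v, G.Adj u v → G.Adj w v) :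
    Contractible (unitSphere Gᶜ w) := by
  rw [unitSphere, induce_compl]
  refine contractible_compl_of_isolated _ ⟨u, ?_⟩ ?_
  · simpa [SimpleGraph.compl_adj, hne.symm] using fun h => hadj h.symm
  · rintro ⟨v, hv⟩ h
    have hv' : Gᶜ.Adj w v := hv
    exact (SimpleGraph.compl_adj _ _ _ |>.1 hv').2 (hsub v (by simpa using h))

/-- The complement of a perfect matching is a cross polytope, hence a discrete sphere. -/
theorem isSphere_compl_of_existsUnique_adj {V : Type u} [Finite V] (G : SimpleGraph V)
    (hG : ∀ x, ∃! y, G.Adj x y) (n : ℕ) (hn : Nat.card V = 2 * n) : IsSphere n Gᶜ := by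
  induction n generalizing V with
  -- `Nat.card` is also `0` on infinite types, which finiteness excludes.
  | zero => exact (Nat.card_eq_zero.1 hn).resolve_right (fun h => not_finite_iff_infinite.2 h ‹_›)
  | succ n ih =>
    refine ⟨fun x => ?_, ?_⟩
    · rw [unitSphere, induce_compl]
      obtain ⟨y, hxy, hy⟩ := hG x
      -- Removing a matched pair leaves a perfect matching, so the induction applies to the unit
      -- sphere.
      have hs : Gᶜ.neighborSet x = {x, y}ᶜ := by
        ext v
        simp only [SimpleGraph.mem_neighborSet, SimpleGraph.compl_adj, Set.mem_compl_iff,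
          Set.mem_insert_iff, Set.mem_singleton_iff, not_or]
        refine and_congr ne_comm (not_congr ⟨hy v, ?_⟩)
        rintro rfl
        exact hxy
      rw [hs]
      apply ih
      · rintro ⟨v, hv⟩
        simp only [Set.mem_compl_iff, Set.mem_insert_iff, Set.mem_singleton_iff, not_or] at hv
        obtain ⟨z, hvz, hz⟩ := hG v
        refine ⟨⟨z, ?_⟩, by simpa using hvz, ?_⟩
        · simp only [Set.mem_compl_iff, Set.mem_insert_iff, Set.mem_singleton_iff, not_or]
          refine ⟨?_, ?_⟩
          · rintro rfl
            exact hv.2 (hy v hvz.symm)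
          · rintro rfl
            exact hv.1 ((hG z).unique hvz.symm hxy.symm)
        · rintro ⟨z', hz'⟩ h
          exact Subtype.ext (hz z' (by simpa using h))
      · have h1 := Set.ncard_add_ncard_compl ({x, y} : Set V)
        rw [Set.ncard_pair hxy.ne, hn] at h1
        rw [Nat.card_coe_set_eq]
        omega
    · have : Nonempty V := (Nat.card_pos_iff.1 (by omega : 0 < Nat.card V)).1
      obtain ⟨x⟩ := this
      obtain ⟨y, hxy, -⟩ := hG x
      refine ⟨x, ?_⟩
      rw [deleteVertex, induce_compl]
      -- Once `x` is gone, its partner `y` is isolated in the matching.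
      refine contractible_compl_of_isolated _ ⟨y, by simpa using hxy.ne'⟩ ?_
      rintro ⟨v, hv⟩ h
      exact hv ((hG y).unique (by simpa using h) hxy.symm)

/-! ### Forests without domination -/

/-- A finite forest without isolated vertices and without domination between nonadjacent vertices
is a perfect matching. -/
theorem existsUnique_adj_of_isAcyclic {V : Type u} [Finite V] (G : SimpleGraph V)
    (hG : G.IsAcyclic) (hiso : ∀ v, ∃ w, G.Adj v w)
    (hdom : ∀ u w, u ≠ w → ¬ G.Adj u w → ¬ ∀ v, G.Adj u v → G.Adj w v) (x : V) :
    ∃! y, G.Adj x y := by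
  have := Fintype.ofFinite V
  -- A second neighbour `w` of `v` would dominate the leaf `u`.
  have hleaf : ∀ u v, G.Adj u v → (∀ y, G.Adj u y → y = v) → ∀ w, G.Adj v w → w = u := by
    intro u v huv hu w hvw
    by_contra hne
    refine hdom u w (Ne.symm hne) (fun h => hvw.ne (hu w h).symm) fun y hy => ?_
    rw [hu y hy]
    exact hvw.symm
  -- A longest path starting at `x` ends in a leaf, by acyclicity and maximality.
  let S : Set ℕ := {n | ∃ (v : V) (p : G.Walk x v), p.IsPath ∧ p.length = n}
  have hS : BddAbove S := ⟨Fintype.card V, by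
    rintro n ⟨v, p, hp, rfl⟩
    exact hp.length_lt.le⟩
  obtain ⟨y, hxy⟩ := hiso x
  have h1 : 1 ∈ S := ⟨y, .cons hxy .nil, by simp [hxy.ne], by simp⟩
  obtain ⟨u, p, hp, hlen⟩ := Nat.sSup_mem ⟨1, h1⟩ hS
  have hpos : 1 ≤ p.length := hlen ▸ le_csSup hS h1
  have hnil : ¬ p.Nil := by
    rw [← SimpleGraph.Walk.length_eq_zero_iff]
    omega
  have hu : ∀ y, G.Adj u y → y = p.penultimate := by
    intro y huy
    refine hG.eq_penultimate_of_adj_end hp huy ?_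
    by_contra hy
    have h2 : p.length + 1 ∈ S := ⟨y, p.concat huy, hp.concat hy huy, by simp⟩
    have := le_csSup hS h2
    omega
  have hv := hleaf u p.penultimate (p.adj_penultimate hnil).symm hu
  -- On a path of length at least 2, the vertex before the penultimate one would be a neighbour of
  -- it other than the leaf `u`, against `hv`. So the path is a single edge.
  have hx : p.penultimate = x := by
    rcases hpos.eq_or_lt with h | h
    · simp [SimpleGraph.Walk.penultimate, ← h]
    · have hadj := p.adj_getVert_succ (i := p.length - 2) (by omega)
      rw [show p.length - 2 + 1 = p.length - 1 by omega] at hadj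
      have h3 := hv _ hadj.symm
      have h4 := hp.getVert_injOn (x₁ := p.length - 2) (x₂ := p.length) (by simp) (by simp)
        (by simpa using h3)
      omega
  rw [hx] at hv
  exact ⟨u, hx ▸ p.adj_penultimate hnil, hv⟩

/-! ### Realizations of independence complexes -/

/-- The support of `p` serves as the face; it is nonempty because the coordinates sum to 1. This
turns membership into a condition on edges alone. -/
theorem mem_realization_independenceComplex {V : Type u} [Fintype V] (G : SimpleGraph V)
    (p : V → ℝ) : p ∈ realization (independenceComplex G) ↔
      p ∈ stdSimplex ℝ V ∧ ∀ v w, G.Adj v w → p v = 0 ∨ p w = 0 := by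
  refine and_congr_right fun hp => ⟨?_, fun h => ?_⟩
  · rintro ⟨s, ⟨-, hs⟩, hps⟩ v w hvw
    by_contra! hne
    refine hs (not_not.1 (mt (hps v) hne.1)) (not_not.1 (mt (hps w) hne.2)) hvw.ne hvw
  · classical
    refine ⟨Finset.univ.filter fun v => p v ≠ 0, ⟨?_, ?_⟩, by simp⟩
    · by_contra he
      rw [Finset.not_nonempty_iff_eq_empty, Finset.filter_eq_empty_iff] at he
      have h0 : ∑ v, p v = 0 := Finset.sum_eq_zero fun v hv => not_not.1 (he hv)
      exact zero_ne_one (h0.symm.trans hp.2)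
    · intro v hv w hw _ hvw
      simp only [Finset.coe_filter, Finset.mem_univ, true_and, Set.mem_ofPred_eq] at hv hw
      exact (h v w hvw).elim hv hw

/-- The independence complex of a graph with an isolated vertex is a topological cone. -/
theorem contractibleSpace_realization_of_isolated {V : Type u} [Fintype V] (G : SimpleGraph V)
    (u : V) (hu : ∀ v, ¬ G.Adj u v) :
    ContractibleSpace (realization (independenceComplex G)) := by
  classical
  have hmem : Pi.single u (1 : ℝ) ∈ realization (independenceComplex G) := by
    refine (mem_realization_independenceComplex _ _).2 ⟨single_mem_stdSimplex ℝ u, ?_⟩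
    intro v w hvw
    exact .inl (Pi.single_eq_of_ne (by rintro rfl; exact hu w hvw) _)
  refine StarConvex.contractibleSpace (x := Pi.single u (1 : ℝ)) ?_ ⟨_, hmem⟩
  intro p hp a b ha hb hab
  rw [mem_realization_independenceComplex] at hp hmem ⊢
  refine ⟨convex_stdSimplex ℝ V hmem.1 hp.1 ha hb hab, fun v w hvw => ?_⟩
  have hv : v ≠ u := by rintro rfl; exact hu w hvw
  have hw : w ≠ u := by rintro rfl; exact hu v hvw.symm
  simpa [hv, hw] using (hp.2 v w hvw).imp Or.inr Or.inr

/-! ### Deformation retraction onto the deletion of a dominating vertex -/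

open Classical in
/-- Transport of the fraction `t` of the mass at `w` to `u`. -/
noncomputable def moveMass {V : Type u} (u w : V) (t : ℝ) (p : V → ℝ) : V → ℝ :=
  p + (t * p w) • (Pi.single u 1 - Pi.single w 1)

/-- Only edges at `u` can go wrong. A neighbour `v` of `u` is also one of `w`, so either `p v = 0`
or both `p u` and `p w` vanish, and then `u` receives nothing. -/
theorem moveMass_mem {V : Type u} [Fintype V] (G : SimpleGraph V) {u w : V}
    (hne : u ≠ w) (hadj : ¬ G.Adj u w) (hsub : ∀ v, G.Adj u v → G.Adj w v)
    {t : ℝ} (h0 : 0 ≤ t) (h1 : t ≤ 1) {p : V → ℝ}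
    (hp : p ∈ realization (independenceComplex G)) :
    moveMass u w t p ∈ realization (independenceComplex G) := by
  classical
  rw [mem_realization_independenceComplex] at hp ⊢
  obtain ⟨⟨hpos, hsum⟩, hp⟩ := hp
  refine ⟨⟨fun v => ?_, ?_⟩, ?_⟩
  · have hw := hpos w
    have hv := hpos v
    by_cases hvw : v = w
    · subst hvw
      simp only [moveMass, Pi.add_apply, Pi.smul_apply, Pi.sub_apply, Pi.single_eq_same,
        Pi.single_eq_of_ne hne.symm, smul_eq_mul]
      nlinarith
    · have : (0 : ℝ) ≤ (Pi.single u 1 : V → ℝ) v :=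
        (Pi.single_nonneg.2 zero_le_one : (0 : V → ℝ) ≤ _) v
      simp only [moveMass, Pi.add_apply, Pi.smul_apply, Pi.sub_apply,
        Pi.single_eq_of_ne hvw, smul_eq_mul, sub_zero]
      positivity
  · simp [moveMass, Finset.sum_add_distrib, ← Finset.mul_sum, hsum]
  · have key : ∀ v, v ≠ u → p v = 0 → moveMass u w t p v = 0 := by
      intro v hv hpv
      by_cases hvw : v = w
      · subst hvw
        simp [moveMass, hpv]
      · simp [moveMass, hpv, hv, hvw]
    have key' : ∀ v, G.Adj u v → moveMass u w t p u = 0 ∨ moveMass u w t p v = 0 := by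
      intro v huv
      rcases hp u v huv with h | h
      · rcases hp w v (hsub v huv) with h' | h'
        · left
          simp [moveMass, h, h']
        · exact .inr (key v huv.ne' h')
      · exact .inr (key v huv.ne' h)
    intro v v' hvv
    by_cases hv : v = u
    · subst hv
      exact key' v' hvv
    by_cases hv' : v' = u
    · subst hv'
      exact (key' v hvv.symm).symm
    exact (hp v v' hvv).imp (key v hv) (key v' hv')

theorem moveMass_one_self {V : Type u} {u w : V} (hne : u ≠ w) (p : V → ℝ) :
    moveMass u w 1 p w = 0 := by
  simp [moveMass, hne.symm]

theorem moveMass_of_apply_eq_zero {V : Type u} {u w : V} (t : ℝ) {p : V → ℝ} (hp : p w = 0) :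
    moveMass u w t p = p := by
  simp [moveMass, hp]

theorem moveMass_zero {V : Type u} {u w : V} (p : V → ℝ) : moveMass u w 0 p = p := by
  simp [moveMass]

theorem continuous_moveMass {V : Type u} (u w : V) :
    Continuous fun x : ℝ × (V → ℝ) => moveMass u w x.1 x.2 := by
  unfold moveMass
  fun_prop

open Classical in
/-- Extension by zero from the complement of `w`. -/
noncomputable def extendZero {V : Type u} (w : V) (p : (({w} : Set V)ᶜ : Set V) → ℝ) : V → ℝ :=
  fun v => if h : v ∈ (({w} : Set V)ᶜ : Set V) then p ⟨v, h⟩ else 0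

theorem extendZero_self {V : Type u} (w : V) (p : (({w} : Set V)ᶜ : Set V) → ℝ) :
    extendZero w p w = 0 := by
  simp [extendZero]

theorem extendZero_coe {V : Type u} (w : V) (p : (({w} : Set V)ᶜ : Set V) → ℝ)
    (v : (({w} : Set V)ᶜ : Set V)) : extendZero w p v = p v := by
  unfold extendZero
  rw [dif_pos v.2]

theorem extendZero_restrict {V : Type u} {w : V} {p : V → ℝ} (hp : p w = 0) :
    extendZero w (fun v => p v) = p := by
  ext v
  by_cases hv : v = w
  · subst hv
    rw [extendZero_self, hp]
  · exact extendZero_coe w _ ⟨v, hv⟩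

theorem continuous_extendZero {V : Type u} (w : V) : Continuous (extendZero w) := by
  refine continuous_pi fun v => ?_
  by_cases hv : v = w
  · subst hv
    simp only [extendZero_self]
    exact continuous_const
  · simp only [fun p => extendZero_coe w p ⟨v, hv⟩]
    exact continuous_apply _

theorem sum_compl_singleton {V : Type u} [Fintype V] (w : V)
    [Fintype (({w} : Set V)ᶜ : Set V)] (p : V → ℝ) (hp : p w = 0) :
    ∑ v : (({w} : Set V)ᶜ : Set V), p v = ∑ v, p v := by
  classical
  rw [← Fintype.sum_subtype_add_sum_subtype (fun v => v ∈ (({w} : Set V)ᶜ : Set V)) p]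
  rw [Fintype.sum_eq_zero (fun v : {v // ¬ v ∈ (({w} : Set V)ᶜ : Set V)} => p v), add_zero]
  · exact Finset.sum_congr (by ext; simp) fun _ _ => rfl
  · rintro ⟨v, hv⟩
    simp only [Set.mem_compl_iff, Set.mem_singleton_iff, not_not] at hv
    subst hv
    exact hp

/-- Identifies the realization for `G - w` with the part of the realization for `G` where the mass
at `w` is zero. -/
theorem extendZero_mem_iff {V : Type u} [Fintype V] (G : SimpleGraph V) (w : V)
    [Fintype (({w} : Set V)ᶜ : Set V)] (p : (({w} : Set V)ᶜ : Set V) → ℝ) :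
    extendZero w p ∈ realization (independenceComplex G) ↔
      p ∈ realization (independenceComplex (deleteVertex G w)) := by
  simp only [mem_realization_independenceComplex, stdSimplex, Set.mem_ofPred_eq,
    ← sum_compl_singleton w _ (extendZero_self w p), extendZero_coe]
  refine and_congr (and_congr_left' ⟨fun h v => ?_, fun h v => ?_⟩) ⟨fun h v v' hv => ?_,
    fun h v v' hv => ?_⟩
  · simpa [extendZero_coe] using h v
  · by_cases hv : v = w
    · subst hv
      rw [extendZero_self]
    · simpa using (h ⟨v, hv⟩).trans_eq (extendZero_coe w p ⟨v, hv⟩).symm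
  · simpa [extendZero_coe] using h v v' (by simpa using hv)
  · by_cases h1 : v = w
    · subst h1
      exact .inl (extendZero_self _ _)
    by_cases h2 : v' = w
    · subst h2
      exact .inr (extendZero_self _ _)
    have := h ⟨v, h1⟩ ⟨v', h2⟩ (by simpa using hv)
    rwa [← extendZero_coe w p ⟨v, h1⟩, ← extendZero_coe w p ⟨v', h2⟩] at this

/-- Deleting a vertex which dominates a nonadjacent vertex does not change the homotopy type of the
independence complex. -/
theorem nonempty_homotopyEquiv_deleteVertex {V : Type u} [Fintype V] (G : SimpleGraph V) {u w : V}
    [Fintype (({w} : Set V)ᶜ : Set V)]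
    (hne : u ≠ w) (hadj : ¬ G.Adj u w) (hsub : ∀ v, G.Adj u v → G.Adj w v) :
    Nonempty (ContinuousMap.HomotopyEquiv (realization (independenceComplex G))
      (realization (independenceComplex (deleteVertex G w)))) := by
  have hres : ∀ p : realization (independenceComplex G),
      (fun v : (({w} : Set V)ᶜ : Set V) => moveMass u w 1 p v) ∈
        realization (independenceComplex (deleteVertex G w)) := fun p => by
    rw [← extendZero_mem_iff, extendZero_restrict (moveMass_one_self hne p)]
    exact moveMass_mem G hne hadj hsub zero_le_one le_rfl p.2
  have hcont := continuous_moveMass u w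
  let r : C(realization (independenceComplex G),
      realization (independenceComplex (deleteVertex G w))) :=
    ⟨fun p => ⟨_, hres p⟩, by
      refine Continuous.subtype_mk (continuous_pi fun v => ?_) _
      exact (continuous_apply (v : V)).comp
        (hcont.comp (continuous_const.prodMk continuous_subtype_val))⟩
  let i : C(realization (independenceComplex (deleteVertex G w)),
      realization (independenceComplex G)) :=
    ⟨fun p => ⟨extendZero w p, (extendZero_mem_iff G w p).2 p.2⟩,
      ((continuous_extendZero w).comp continuous_subtype_val).subtype_mk _⟩
  have hri : r.comp i = ContinuousMap.id _ := by
    ext p v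
    change moveMass u w 1 (extendZero w p) v = p.1 v
    rw [moveMass_of_apply_eq_zero _ (extendZero_self w _), extendZero_coe]
  refine ⟨⟨r, i, ?_, by rw [hri]⟩⟩
  -- The homotopy transports a growing fraction of the mass, from the identity at time 0 to `i.comp
  -- r` at time 1.
  refine ContinuousMap.Homotopic.symm ⟨⟨⟨fun x => ⟨moveMass u w x.1 x.2,
    moveMass_mem G hne hadj hsub x.1.2.1 x.1.2.2 x.2.2⟩, ?_⟩, fun p => ?_, fun p => ?_⟩⟩
  · exact (hcont.comp (by fun_prop : Continuous fun x : unitInterval ×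
      realization (independenceComplex G) => ((x.1 : ℝ), (x.2 : V → ℝ)))).subtype_mk _
  · exact Subtype.ext (by simp [moveMass_zero])
  · refine Subtype.ext ?_
    change moveMass u w ((1 : unitInterval) : ℝ) p = extendZero w fun v => moveMass u w 1 p v
    rw [extendZero_restrict (moveMass_one_self hne p), Set.Icc.coe_one]

/-! ### Cross polytopes and Euclidean spheres -/

/-- The vertices of a perfect matching can be labelled by the edges and a sign. -/
theorem exists_equiv_prod_bool {V : Type u} [Fintype V] (G : SimpleGraph V)
    (hG : ∀ x, ∃! y, G.Adj x y) : ∃ (n : ℕ) (φ : Fin n × Bool ≃ V),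
      ∀ i b v, G.Adj (φ (i, b)) v ↔ v = φ (i, !b) := by
  choose σ hσ hσ' using hG
  have hinv : ∀ v, σ (σ v) = v := fun v => (hσ' _ _ (hσ v).symm).symm
  have hadj : ∀ v w, G.Adj v w ↔ w = σ v := fun v w => ⟨hσ' v w, by rintro rfl; exact hσ v⟩
  let e := Fintype.equivFin V
  -- An arbitrary numbering of the vertices selects one endpoint of each edge.
  let T := {v // e v < e (σ v)}
  have : Fintype T := Fintype.ofFinite T
  let f : T × Bool → V := fun x => bif x.2 then x.1 else σ x.1
  have hf : Function.Bijective f := by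
    constructor
    · rintro ⟨⟨a, ha⟩, b⟩ ⟨⟨a', ha'⟩, b'⟩ h
      cases b <;> cases b' <;> simp only [f, cond_true, cond_false] at h
      · have : a = a' := by rw [← hinv a, h, hinv]
        subst this
        rfl
      · subst h
        rw [hinv] at ha'
        exact absurd ha' ha.not_gt
      · subst h
        rw [hinv] at ha
        exact absurd ha' ha.not_gt
      · subst h
        rfl
    · intro v
      rcases lt_or_gt_of_ne (e.injective.ne (hσ v).ne) with h | h
      · exact ⟨(⟨v, h⟩, true), rfl⟩
      · exact ⟨(⟨σ v, by rwa [hinv]⟩, false), hinv v⟩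
  refine ⟨Fintype.card T, ((Fintype.equivFin T).symm.prodCongr (.refl _)).trans
    (Equiv.ofBijective f hf), fun i b v => ?_⟩
  rw [hadj]
  cases b <;> simp [f, hinv]

/-- The difference of the two coordinates on each edge. -/
noncomputable def edgeDiff {V : Type u} {n : ℕ} (φ : Fin n × Bool ≃ V) (p : V → ℝ) :
    EuclideanSpace ℝ (Fin n) :=
  WithLp.toLp 2 fun i => p (φ (i, true)) - p (φ (i, false))

/-- Positive and negative parts of the coordinates of a vector. -/
noncomputable def signedParts {V : Type u} {n : ℕ} (φ : Fin n × Bool ≃ V)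
    (y : EuclideanSpace ℝ (Fin n)) : V → ℝ :=
  fun v => max (bif (φ.symm v).2 then y (φ.symm v).1 else - y (φ.symm v).1) 0

theorem sum_signedParts {V : Type u} [Fintype V] {n : ℕ} (φ : Fin n × Bool ≃ V)
    (y : EuclideanSpace ℝ (Fin n)) : ∑ v, signedParts φ y v = ∑ i, |y i| := by
  rw [← φ.sum_comp, Fintype.sum_prod_type]
  refine Finset.sum_congr rfl fun i _ => ?_
  simp only [signedParts, Equiv.symm_apply_apply, Fintype.sum_bool, cond_true, cond_false]
  rcases le_total 0 (y i) with h | h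
  · rw [max_eq_left h, max_eq_right (by linarith), abs_of_nonneg h, add_zero]
  · rw [max_eq_right h, max_eq_left (by linarith), abs_of_nonpos h, zero_add]

theorem edgeDiff_signedParts {V : Type u} {n : ℕ} (φ : Fin n × Bool ≃ V)
    (y : EuclideanSpace ℝ (Fin n)) : edgeDiff φ (signedParts φ y) = y := by
  ext i
  simp only [edgeDiff, signedParts, Equiv.symm_apply_apply, cond_true, cond_false]
  rcases le_total 0 (y i) with h | h
  · rw [max_eq_left h, max_eq_right (by linarith), sub_zero]
  · rw [max_eq_right h, max_eq_left (by linarith), zero_sub, neg_neg]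

/-- Two nonnegative numbers, one of them zero, are the positive and negative parts of their
difference. -/
theorem signedParts_edgeDiff {V : Type u} {n : ℕ} (φ : Fin n × Bool ≃ V) {p : V → ℝ}
    (hp : ∀ v, 0 ≤ p v) (h : ∀ i, p (φ (i, true)) = 0 ∨ p (φ (i, false)) = 0) :
    signedParts φ (edgeDiff φ p) = p := by
  ext v
  obtain ⟨⟨i, b⟩, rfl⟩ := φ.surjective v
  have h1 := hp (φ (i, true))
  have h2 := hp (φ (i, false))
  simp only [edgeDiff, signedParts, Equiv.symm_apply_apply]
  cases b <;> rcases h i with h | h <;> simp [h, h1, h2]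

theorem edgeDiff_smul {V : Type u} {n : ℕ} (φ : Fin n × Bool ≃ V) (c : ℝ) (p : V → ℝ) :
    edgeDiff φ (c • p) = c • edgeDiff φ p := by
  ext i
  simp [edgeDiff, mul_sub]

theorem signedParts_smul {V : Type u} {n : ℕ} (φ : Fin n × Bool ≃ V) {c : ℝ} (hc : 0 ≤ c)
    (y : EuclideanSpace ℝ (Fin n)) : signedParts φ (c • y) = c • signedParts φ y := by
  ext v
  simp only [signedParts, PiLp.smul_apply, Pi.smul_apply, smul_eq_mul]
  rw [mul_max_of_nonneg _ _ hc, mul_zero]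
  cases (φ.symm v).2 <;> simp

theorem continuous_edgeDiff {V : Type u} {n : ℕ} (φ : Fin n × Bool ≃ V) :
    Continuous (edgeDiff φ) := by
  unfold edgeDiff
  fun_prop

theorem continuous_signedParts {V : Type u} {n : ℕ} (φ : Fin n × Bool ≃ V) :
    Continuous (signedParts φ) := by
  refine continuous_pi fun v => ?_
  unfold signedParts
  cases (φ.symm v).2 <;> simp only [cond_true, cond_false] <;> fun_prop

/-- The realization of the boundary of a cross polytope is homeomorphic to a Euclidean sphere. -/
theorem nonempty_homeomorph_sphere {V : Type u} [Fintype V] (G : SimpleGraph V)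
    {n : ℕ} (φ : Fin n × Bool ≃ V) (hφ : ∀ i b v, G.Adj (φ (i, b)) v ↔ v = φ (i, !b)) :
    Nonempty (realization (independenceComplex G) ≃ₜ
      Metric.sphere (0 : EuclideanSpace ℝ (Fin n)) 1) := by
  have hmem : ∀ p, p ∈ realization (independenceComplex G) ↔
      ((∀ v, 0 ≤ p v) ∧ ∑ v, p v = 1) ∧ ∀ i, p (φ (i, true)) = 0 ∨ p (φ (i, false)) = 0 := by
    intro p
    rw [mem_realization_independenceComplex]
    refine and_congr_right fun _ => ⟨fun h i => h _ _ ((hφ i true _).2 rfl), ?_⟩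
    intro h v w hvw
    obtain ⟨⟨i, b⟩, rfl⟩ := φ.surjective v
    rw [(hφ i b w).1 hvw]
    cases b
    · exact (h i).symm
    · exact h i
  have hleft : ∀ p ∈ realization (independenceComplex G), signedParts φ (edgeDiff φ p) = p :=
    fun p hp => signedParts_edgeDiff φ ((hmem p).1 hp).1.1 ((hmem p).1 hp).2
  have hne : ∀ p ∈ realization (independenceComplex G), edgeDiff φ p ≠ 0 := by
    intro p hp h0
    have h1 := ((hmem p).1 hp).1.2
    rw [← hleft p hp, sum_signedParts, h0] at h1
    simp at h1
  have hpos : ∀ y ∈ Metric.sphere (0 : EuclideanSpace ℝ (Fin n)) 1, 0 < ∑ i, |y i| := by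
    intro y hy
    refine (Finset.sum_nonneg fun i _ => abs_nonneg (y i)).lt_of_ne fun h => ?_
    rw [eq_comm, Finset.sum_eq_zero_iff_of_nonneg fun i _ => abs_nonneg (y i)] at h
    have : y = 0 := by
      ext i
      simpa using h i (Finset.mem_univ i)
    simp [this] at hy
  -- Radial projection in both directions: divide by the ℓ² norm to reach the sphere, and by the ℓ¹
  -- norm to return, since `signedParts` turns the ℓ¹ norm into total mass.
  refine ⟨{
    toFun := fun p => ⟨‖edgeDiff φ p‖⁻¹ • edgeDiff φ p, ?_⟩
    invFun := fun y => ⟨(∑ i, |y.1 i|)⁻¹ • signedParts φ y, ?_⟩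
    left_inv := fun p => ?_
    right_inv := fun y => ?_
    continuous_toFun := ?_
    continuous_invFun := ?_ }⟩
  · have := norm_ne_zero_iff.2 (hne p p.2)
    simp [norm_smul, this]
  · have hy := hpos y y.2
    rw [hmem]
    refine ⟨⟨fun v => mul_nonneg (inv_nonneg.2 hy.le) (le_max_right _ _), ?_⟩, fun i => ?_⟩
    · simp only [Pi.smul_apply, ← Finset.smul_sum, sum_signedParts]
      exact inv_mul_cancel₀ hy.ne'
    · rcases le_total 0 (y.1 i) with h | h <;> simp [signedParts, h]
  · refine Subtype.ext ?_
    have hp := norm_pos_iff.2 (hne p p.2)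
    have h1 : ∑ i : Fin n, |edgeDiff φ p i| = 1 := by
      rw [← sum_signedParts φ, hleft p p.2]
      exact ((hmem p).1 p.2).1.2
    change (∑ i : Fin n, |(‖edgeDiff φ p‖⁻¹ • edgeDiff φ p) i|)⁻¹ •
      signedParts φ (‖edgeDiff φ p‖⁻¹ • edgeDiff φ p) = p
    rw [signedParts_smul φ (inv_nonneg.2 hp.le), hleft p p.2]
    simp only [PiLp.smul_apply, smul_eq_mul, abs_mul, ← Finset.mul_sum, h1, abs_inv, abs_norm,
      mul_one, inv_inv]
    exact smul_inv_smul₀ hp.ne' _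
  · refine Subtype.ext ?_
    have hy := hpos y y.2
    change ‖edgeDiff φ ((∑ i : Fin n, |y.1 i|)⁻¹ • signedParts φ y)‖⁻¹ •
      edgeDiff φ ((∑ i : Fin n, |y.1 i|)⁻¹ • signedParts φ y) = y
    rw [edgeDiff_smul, edgeDiff_signedParts, norm_smul, norm_eq_of_mem_sphere y, mul_one,
      norm_inv, Real.norm_of_nonneg hy.le, inv_inv]
    exact smul_inv_smul₀ hy.ne' _
  · have hc : Continuous fun p : realization (independenceComplex G) => edgeDiff φ p :=
      (continuous_edgeDiff φ).comp continuous_subtype_val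
    exact ((hc.norm.inv₀ fun p => norm_ne_zero_iff.2 (hne p p.2)).smul hc).subtype_mk _
  · have hc : Continuous fun y : Metric.sphere (0 : EuclideanSpace ℝ (Fin n)) 1 =>
        signedParts φ y := (continuous_signedParts φ).comp continuous_subtype_val
    have hs : Continuous fun y : Metric.sphere (0 : EuclideanSpace ℝ (Fin n)) 1 =>
        ∑ i, |y.1 i| := by fun_prop
    exact ((hs.inv₀ fun y => (hpos y y.2).ne').smul hc).subtype_mk _

end GraphTop

/-! ### Induction on the number of vertices -/

theorem mainTheorem9 {V : Type u} [Fintype V] [Nonempty V] (G : SimpleGraph V)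
    (hG : G.IsAcyclic) :
    GraphTop.independenceComplex G = GraphTop.whitneyComplex Gᶜ ∧
    ((GraphTop.Contractible Gᶜ ∧
        ContractibleSpace (GraphTop.realization (GraphTop.independenceComplex G))) ∨
      ∃ d : ℕ, GraphTop.HomotopicToSphere d Gᶜ ∧
        Nonempty (ContinuousMap.HomotopyEquiv
          (GraphTop.realization (GraphTop.independenceComplex G))
          (Metric.sphere (0 : EuclideanSpace ℝ (Fin (d + 1))) 1))) := by
  refine ⟨GraphTop.independenceComplex_eq_whitneyComplex_compl G, ?_⟩
  induction hn : Nat.card V using Nat.strong_induction_on generalizing V with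
  | _ n ih =>
    by_cases hiso : ∃ u, ∀ v, ¬ G.Adj u v
    · obtain ⟨u, hu⟩ := hiso
      exact .inl ⟨GraphTop.contractible_compl_of_isolated G u hu,
        GraphTop.contractibleSpace_realization_of_isolated G u hu⟩
    by_cases hdom : ∃ u w, u ≠ w ∧ ¬ G.Adj u w ∧ ∀ v, G.Adj u v → G.Adj w v
    · obtain ⟨u, w, hne, hadj, hsub⟩ := hdom
      have : Fintype (({w} : Set V)ᶜ : Set V) := Fintype.ofFinite _
      have : Nonempty (({w} : Set V)ᶜ : Set V) := ⟨⟨u, hne⟩⟩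
      have hS := GraphTop.contractible_unitSphere_compl G hne hadj hsub
      obtain ⟨E⟩ := GraphTop.nonempty_homotopyEquiv_deleteVertex G hne hadj hsub
      have hcard : Nat.card (({w} : Set V)ᶜ : Set V) < n := by
        rw [← hn]
        exact Finite.card_subtype_lt (x := w) (by simp)
      rcases ih _ hcard (GraphTop.deleteVertex G w) (hG.induce _) rfl with ⟨hc, ht⟩ | ⟨d, hs, ⟨E'⟩⟩
      · rw [← GraphTop.induce_compl] at hc
        exact .inl ⟨.step _ w hS hc, E.contractibleSpace⟩
      · obtain ⟨W, hW, H, hH, hom⟩ := hs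
        rw [← GraphTop.induce_compl] at hom
        exact .inr ⟨d, ⟨W, hW, H, hH, .trans (.reduction _ w hS) hom⟩, ⟨E.trans E'⟩⟩
    · push Not at hiso hdom
      have hmatch := GraphTop.existsUnique_adj_of_isAcyclic G hG hiso
        (fun u w h1 h2 h3 => by
          obtain ⟨v, hv, hv'⟩ := hdom u w h1 h2
          exact hv' (h3 v hv))
      obtain ⟨m, φ, hφ⟩ := GraphTop.exists_equiv_prod_bool G hmatch
      have hV : Nat.card V = 2 * m := by
        rw [← Nat.card_congr φ]
        simp [mul_comm]
      have hV0 : 0 < Nat.card V := Nat.card_pos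
      -- A matching with `m` edges gives a sphere of dimension `m - 1`; nonemptiness of `V` ensures
      -- `m ≥ 1`.
      obtain ⟨d, rfl⟩ : ∃ d, m = d + 1 := ⟨m - 1, by omega⟩
      obtain ⟨h⟩ := GraphTop.nonempty_homeomorph_sphere G φ hφ
      exact .inr ⟨d, ⟨V, inferInstance, Gᶜ,
        GraphTop.isSphere_compl_of_existsUnique_adj G hmatch _ hV, .iso .refl⟩,
        ⟨h.toHomotopyEquiv⟩⟩
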